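/- Let $m\ge 1$ and let $\Theta=(\theta_1\le\dots\le\theta_{n+m})$ be an open knot vector of order $m$ in $[a,b]$, $a<b$: $\theta_1=\dots=\theta_m=a$, $\theta_{n+1}=\dots=\theta_{n+m}=b$, and every knot has multiplicity at most $m$ in $\Theta$. For an order $p\ge 1$ let $$N_{p,k}(x)=(\theta_{k+p}-\theta_k)\,[\theta_k,\dots,\theta_{k+p}\mid(\cdot-x)_+^{p-1}],\qquad 1\le k\le n+m-p,$$ be the B-splines of order $p$ on $\Theta$, where $[\cdots\mid f]$ denotes the divided difference of $f$ (with repeated nodes), and let $h_{j,k}=(\theta_{k+j}-\theta_k)/j$. Let $\Gamma=\bigl(\int_a^b N_{m,j}(x)N_{m,k}(x)\,dx\bigr)_{1\le j,k\le n}$ and, for $0\le r\le m-1$, $$D_{m+r}=\begin{pmatrix}1&-1\\&1&-1\\&&\ddots&\ddots\\&&&1&-1\end{pmatrix}\operatorname{diag}\bigl(h_{m+r,1}^{-1},\dots,h_{m+r,n-r}^{-1}\bigr)\in\mathbb R^{(n-r-1)\times(n-r)}.$$ Let $m+1\le\ell\le n$ with $\theta_{\ell-1}<\theta_\ell$ (so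 $\theta_\ell$ is the first occurrence of an interior knot), let $\mu$ be the multiplicity of $\theta_\ell$ in $\Theta$, let $0\le\nu\le\mu-1$, and let $c_{\ell,\nu}\in\mathbb R^n$ be the vector with entries $$c_{\ell,\nu;k}=\begin{cases}\binom{m-1}{\nu}^{-1}\sigma_{m-1-\nu}(\theta_\ell-\theta_{k+1},\dots,\theta_\ell-\theta_{k+m-1}),&1\le k\le\ell-m+\nu,\\0,&\ell-m+\nu<k\le n,\end{cases}$$ where $\sigma_r$ is the elementary symmetric polynomial of degree $r$. Then the B-splines $N_{2m,k}$, $1\le k\le n-m$, are $\nu$ times continuously differentiable near $\theta_\ell$, and $$c_{\ell,\nu}^T\,\Gamma\,D_m^T D_{m+1}^T\cdots D_{2m-1}^T=(m-1-\nu)!\,\bigl(N_{2m,k}^{(\nu)}(\theta_\ell)\bigr)_{1\le k\le n-m}.$$ -/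

import Mathlib

open scoped Nat Matrix

noncomputable section

/-- The truncated power `s_+^r`: it is `s ^ r` for `s > 0` and `0` for `s ≤ 0`
(so `s_+^0` is the indicator function of `s > 0`). -/
def truncPow (r : ℕ) (s : ℝ) : ℝ := if 0 < s then s ^ r else 0

/-- The divided difference `[t i, t (i+1), …, t (i+r) | f]` for a nondecreasing sequence of
nodes. If the first and the last node agree, then all the nodes agree, and the
divided difference is the Taylor coefficient of order `r` of `f` at this node. -/
def dividedDiff (f : ℝ → ℝ) (t : ℕ → ℝ) : ℕ → ℕ → ℝ
  | 0, i => f (t i)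
  | r + 1, i =>
      if t i = t (i + (r + 1)) then iteratedDeriv (r + 1) f (t i) / ((r + 1)! : ℝ)
      else (dividedDiff f t r (i + 1) - dividedDiff f t r i) / (t (i + (r + 1)) - t i)

/-- The normalized B-spline `N_{p,k}` of order `p ≥ 1` (degree `p - 1`) with knots
`θ k ≤ ⋯ ≤ θ (k+p)`:
`N_{p,k}(x) = (θ_{k+p} - θ_k) [θ_k, …, θ_{k+p} | (· - x)_+^{p-1}]`. -/
def bspline (θ : ℕ → ℝ) (p k : ℕ) (x : ℝ) : ℝ :=
  (θ (k + p) - θ k) * dividedDiff (fun t => truncPow (p - 1) (t - x)) θ p k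

/-- The multiplicity of the real number `x` in the knot vector `θ 1, …, θ N`. -/
def knotMult (θ : ℕ → ℝ) (N : ℕ) (x : ℝ) : ℕ :=
  ((Finset.Icc 1 N).filter (fun i => θ i = x)).card

/-- `θ 1 ≤ ⋯ ≤ θ (n+m)` is an open knot vector of order `m` in `[a, b]`: the endpoints `a` and `b`
are `m`-fold knots, and no knot has a multiplicity greater than `m`. Only the values of `θ` at
`1, …, n+m` matter. -/
structure IsOpenKnotVector (m n : ℕ) (a b : ℝ) (θ : ℕ → ℝ) : Prop where
  lt : a < b
  mono : MonotoneOn θ (Set.Icc 1 (n + m))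
  left : ∀ k ∈ Set.Icc 1 m, θ k = a
  right : ∀ k ∈ Set.Icc (n + 1) (n + m), θ k = b
  mult_le : ∀ x : ℝ, knotMult θ (n + m) x ≤ m

/-- `h_{j,k} = (θ_{k+j} - θ_k) / j`. -/
def knotSpan (θ : ℕ → ℝ) (j k : ℕ) : ℝ := (θ (k + j) - θ k) / (j : ℝ)

/-- The Gram matrix of the B-splines `N_{m,1}, …, N_{m,n}` in `L²(a, b)`.
The index `i : Fin n` stands for the number `i + 1 ∈ {1, …, n}`, here and below. -/
def gramMatrix (m n : ℕ) (a b : ℝ) (θ : ℕ → ℝ) : Matrix (Fin n) (Fin n) ℝ :=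
  Matrix.of fun i j => ∫ x in a..b, bspline θ m (i + 1) x * bspline θ m (j + 1) x

/-- The bidiagonal matrix with rows `(0, …, 0, 1, -1, 0, …, 0)`, with `1` on the diagonal. -/
def bidiag (p q : ℕ) : Matrix (Fin p) (Fin q) ℝ :=
  Matrix.of fun i j =>
    if (j : ℕ) = (i : ℕ) then 1 else if (j : ℕ) = (i : ℕ) + 1 then -1 else 0

/-- The matrix `D_{m+ν}` of size `(n-ν-1) × (n-ν)`: the bidiagonal matrix times
`diag(h_{m+ν,1}⁻¹, …, h_{m+ν,n-ν}⁻¹)`. -/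
def diffMatrix (m n : ℕ) (θ : ℕ → ℝ) (ν : ℕ) : Matrix (Fin (n - (ν + 1))) (Fin (n - ν)) ℝ :=
  bidiag (n - (ν + 1)) (n - ν) *
    Matrix.diagonal fun k : Fin (n - ν) => (knotSpan θ (m + ν) (k + 1))⁻¹

/-- The product `D_mᵀ D_{m+1}ᵀ ⋯ D_{m+r-1}ᵀ` of size `n × (n-r)`. -/
def diffProd (m n : ℕ) (θ : ℕ → ℝ) : (r : ℕ) → Matrix (Fin n) (Fin (n - r)) ℝ
  | 0 => (1 : Matrix (Fin n) (Fin n) ℝ)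
  | r + 1 => diffProd m n θ r * (diffMatrix m n θ r)ᵀ

/-- The coefficient `c_{ℓ,ν;k}`, `1 ≤ k ≤ n`: it is
`σ_{m-1-ν}(θ_ℓ - θ_{k+1}, …, θ_ℓ - θ_{k+m-1}) / binom(m-1, ν)` if `k ≤ ℓ - m + ν`, and `0` for the
larger `k`; here `σ_r` is the elementary symmetric polynomial of degree `r`. -/
def truncCoeff (m : ℕ) (θ : ℕ → ℝ) (ℓ ν k : ℕ) : ℝ :=
  if k + m ≤ ℓ + ν then
    1 / ((m - 1).choose ν : ℝ) *
      ((Finset.Icc (k + 1) (k + m - 1)).val.map fun i => θ ℓ - θ i).esymm (m - 1 - ν)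
  else 0

/-- The vector `c_{ℓ,ν} ∈ ℝⁿ`. -/
def truncCoeffVec (m n : ℕ) (θ : ℕ → ℝ) (ℓ ν : ℕ) : Fin n → ℝ :=
  fun k => truncCoeff m θ ℓ ν (k + 1)

end

/-! The vector c_{ℓ,ν} lists the B-spline coefficients of a single truncated power: off the knots,
Σ_k c_{ℓ,ν;k} N_{m,k}(x) = (θ_ℓ - x)_+^{m-1-ν} for x > a. This is a truncated Marsden identity,
`sum_truncCoeff_mul_jetDividedDiff`. Each factor D^T performs one step of the divided difference
recursion, so column k of the product turns the N_{m,j}(x) into a multiple of [θ_k, …, θ_{k+2m} | (·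
- x)_+^{m-1}] (`sum_jetDividedDiff_mul_diffProd`).

Each entry is therefore an integral from which the divided difference in τ can be pulled out. With y
= θ_ℓ and q = m-1-ν, the integral of (y - x)_+^q (τ - x)_+^{m-1} over [a, b] is a polynomial in τ of
degree at most q + m < 2m plus a Beta constant times (τ - y)_+^{q+m}. Order 2m annihilates the
polynomial; what remains is N_{2m,k}^{(ν)}(y) up to constants (`sum_weights_mul_integral_truncPow`).

An m-fold knot calls for the derivative of order m-1 of (· - x)_+^{m-1}, which breaks down at a knot
equal to x. Divided differences hence act on formal families of Taylor coefficients, as finite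
weighted sums (`exists_weights_jetDividedDiff`), and the order m formulas are used only almost
everywhere. -/

open Finset

/-! ### Divided differences of families of Taylor coefficients -/

/-- The divided difference with repeated nodes of a family of Taylor coefficients: `F τ j` plays the
role of `f^{(j)}(τ) / j!`. -/
noncomputable def jetDividedDiff (F : ℝ → ℕ → ℝ) (t : ℕ → ℝ) : ℕ → ℕ → ℝ
  | 0, i => F (t i) 0
  | r + 1, i =>
      if t i = t (i + (r + 1)) then F (t i) (r + 1)
      else (jetDividedDiff F t r (i + 1) - jetDividedDiff F t r i) / (t (i + (r + 1)) - t i)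

theorem dividedDiff_eq_jetDividedDiff (f : ℝ → ℝ) (t : ℕ → ℝ) (r i : ℕ) :
    dividedDiff f t r i = jetDividedDiff (fun τ j => iteratedDeriv j f τ / (j ! : ℝ)) t r i := by
  induction r generalizing i with
  | zero => simp [dividedDiff, jetDividedDiff]
  | succ r ih => simp [dividedDiff, jetDividedDiff, ih]

theorem jetDividedDiff_of_eq (F : ℝ → ℕ → ℝ) {t : ℕ → ℝ} {r i : ℕ} (h : t i = t (i + r)) :
    jetDividedDiff F t r i = F (t i) r := by
  cases r with
  | zero => rfl
  | succ r => simp [jetDividedDiff, h]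

theorem jetDividedDiff_succ_of_ne (F : ℝ → ℕ → ℝ) {t : ℕ → ℝ} {r i : ℕ}
    (h : t i ≠ t (i + (r + 1))) :
    jetDividedDiff F t (r + 1) i =
      (jetDividedDiff F t r (i + 1) - jetDividedDiff F t r i) / (t (i + (r + 1)) - t i) := by
  simp [jetDividedDiff, h]

theorem eq_of_le_of_le_of_eq {t : ℕ → ℝ} {N i j k : ℕ} (ht : MonotoneOn t (Set.Icc 1 N))
    (hi : 1 ≤ i) (hij : i ≤ j) (hjk : j ≤ k) (hk : k ≤ N) (h : t i = t k) : t j = t i :=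
  le_antisymm
    (h ▸ ht ⟨by omega, by omega⟩ ⟨by omega, by omega⟩ hjk)
    (ht ⟨by omega, by omega⟩ ⟨by omega, by omega⟩ hij)

/-- The recursion of divided differences, cleared of the denominator, also holds when all nodes
coincide. -/
theorem sub_mul_jetDividedDiff (F : ℝ → ℕ → ℝ) {t : ℕ → ℝ} {N r i : ℕ}
    (ht : MonotoneOn t (Set.Icc 1 N)) (hi : 1 ≤ i) (hN : i + (r + 1) ≤ N) :
    (t (i + (r + 1)) - t i) * jetDividedDiff F t (r + 1) i =
      jetDividedDiff F t r (i + 1) - jetDividedDiff F t r i := by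
  by_cases h : t i = t (i + (r + 1))
  · have h1 : t (i + 1) = t i := eq_of_le_of_le_of_eq ht hi (by omega) (by omega) hN h
    have h2 : t (i + r) = t i := eq_of_le_of_le_of_eq ht hi (by omega) (by omega) hN h
    rw [jetDividedDiff_of_eq F h2.symm, jetDividedDiff_of_eq (i := i + 1), ← h, h1]
    · ring
    · rw [h1, h]; congr 1; omega
  · rw [jetDividedDiff_succ_of_ne F h, mul_div_cancel₀ _ (sub_ne_zero.2 (Ne.symm h))]

/-- If no node is repeated more than `M` times, then a divided difference is a linear combination
of derivatives of order less than `M` at the nodes. -/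
theorem exists_weights_jetDividedDiff {t : ℕ → ℝ} {N M : ℕ} (ht : MonotoneOn t (Set.Icc 1 N))
    (hM : 1 ≤ M) (hlt : ∀ i, 1 ≤ i → i + M ≤ N → t i < t (i + M)) (r : ℕ) :
    ∀ i, 1 ≤ i → i + r ≤ N → ∃ w : ℕ → ℕ → ℝ, ∀ F : ℝ → ℕ → ℝ,
      jetDividedDiff F t r i = ∑ k ∈ Icc 1 N, ∑ j ∈ range M, w k j * F (t k) j := by
  have base : ∀ r i, r < M → 1 ≤ i → i ≤ N → t i = t (i + r) →
      ∃ w : ℕ → ℕ → ℝ, ∀ F : ℝ → ℕ → ℝ,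
      jetDividedDiff F t r i = ∑ k ∈ Icc 1 N, ∑ j ∈ range M, w k j * F (t k) j := by
    intro r i hr hi hN h
    refine ⟨fun k j => if k = i then (if j = r then 1 else 0) else 0, fun F => ?_⟩
    rw [jetDividedDiff_of_eq F h, sum_eq_single_of_mem i (mem_Icc.2 ⟨hi, hN⟩),
      sum_eq_single_of_mem r (mem_range.2 hr)]
    · simp
    · intro j _ hj; simp [hj]
    · intro k _ hk; simp [hk]
  induction r with
  | zero => exact fun i hi hN => base 0 i hM hi (by omega) rfl
  | succ r ih =>
    intro i hi hN
    by_cases h : t i = t (i + (r + 1))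
    · refine base (r + 1) i ?_ hi (by omega) h
      -- A run of more than `M` equal nodes contradicts `hlt`, so no derivative of order `M` or
      -- higher occurs.
      by_contra hr
      have := hlt i hi (by omega)
      have := eq_of_le_of_le_of_eq (j := i + M) ht hi (by omega) (by omega) hN h
      linarith
    · obtain ⟨w₁, h₁⟩ := ih (i + 1) (by omega) (by omega)
      obtain ⟨w₂, h₂⟩ := ih i hi (by omega)
      refine ⟨fun k j => (w₁ k j - w₂ k j) / (t (i + (r + 1)) - t i), fun F => ?_⟩
      rw [jetDividedDiff_succ_of_ne F h, h₁, h₂, ← sum_sub_distrib, sum_div]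
      refine sum_congr rfl fun k _ => ?_
      rw [← sum_sub_distrib, sum_div]
      exact sum_congr rfl fun j _ => by ring

/-- The Leibniz rule for the product with a linear factor `τ - c`. -/
theorem jetDividedDiff_mul_linear {F G : ℝ → ℕ → ℝ} {c : ℝ} (h0 : ∀ τ, G τ 0 = (τ - c) * F τ 0)
    (hs : ∀ τ j, G τ (j + 1) = (τ - c) * F τ (j + 1) + F τ j) {t : ℕ → ℝ} {N : ℕ}
    (ht : MonotoneOn t (Set.Icc 1 N)) (r : ℕ) : ∀ i, 1 ≤ i → i + (r + 1) ≤ N →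
    jetDividedDiff G t (r + 1) i =
      (t (i + (r + 1)) - c) * jetDividedDiff F t (r + 1) i + jetDividedDiff F t r i := by
  have key : ∀ r i, 1 ≤ i → i + (r + 1) ≤ N → t i = t (i + (r + 1)) →
      jetDividedDiff G t (r + 1) i =
      (t (i + (r + 1)) - c) * jetDividedDiff F t (r + 1) i + jetDividedDiff F t r i := by
    intro r i hi hN h
    have h2 : t (i + r) = t i := eq_of_le_of_le_of_eq ht hi (by omega) (by omega) hN h
    rw [jetDividedDiff_of_eq G h, jetDividedDiff_of_eq F h, jetDividedDiff_of_eq F h2.symm, hs, h]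
  induction r with
  | zero =>
    intro i hi hN
    by_cases h : t i = t (i + (0 + 1))
    · exact key 0 i hi hN h
    · have h' : t (i + 1) - t i ≠ 0 := sub_ne_zero.2 (Ne.symm h)
      rw [jetDividedDiff_succ_of_ne G h, jetDividedDiff_succ_of_ne F h]
      simp only [jetDividedDiff, h0, zero_add]
      field_simp
      ring
  | succ r ih =>
    intro i hi hN
    by_cases h : t i = t (i + (r + 1 + 1))
    · exact key (r + 1) i hi hN h
    · have h' : t (i + (r + 1 + 1)) - t i ≠ 0 := sub_ne_zero.2 (Ne.symm h)
      have e := sub_mul_jetDividedDiff F (r := r) ht hi (by omega)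
      rw [jetDividedDiff_succ_of_ne G h, jetDividedDiff_succ_of_ne F h, ih _ hi (by omega),
        ih (i + 1) (by omega) (by omega), show i + 1 + (r + 1) = i + (r + 1 + 1) by omega]
      field_simp
      linear_combination -e

/-- Divided differences of order `r` annihilate polynomials of degree less than `r`. -/
theorem jetDividedDiff_pow_eq_zero (c : ℝ) {t : ℕ → ℝ} {N : ℕ} (ht : MonotoneOn t (Set.Icc 1 N))
    (d : ℕ) : ∀ r i, d < r → 1 ≤ i → i + r ≤ N →
    jetDividedDiff (fun τ j => (d.choose j : ℝ) * (τ - c) ^ (d - j)) t r i = 0 := by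
  induction d with
  | zero =>
    intro r
    induction r with
    | zero => intro i h; omega
    | succ r ih =>
      intro i _ hi hN
      by_cases h : t i = t (i + (r + 1))
      · rw [jetDividedDiff_of_eq _ h]; simp
      · rw [jetDividedDiff_succ_of_ne _ h]
        rcases Nat.eq_zero_or_pos r with rfl | hr
        · simp [jetDividedDiff]
        · rw [ih _ hr hi (by omega), ih _ hr (by omega) (by omega)]; simp
  | succ d ih =>
    intro r i hr hi hN
    obtain ⟨r, rfl⟩ : ∃ s, r = s + 1 := ⟨r - 1, by omega⟩
    -- Splitting off one factor τ - c lowers the degree by one and the order by at most one.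
    rw [jetDividedDiff_mul_linear (F := fun τ j => (d.choose j : ℝ) * (τ - c) ^ (d - j)) (c := c)
      _ _ ht r i hi hN, ih _ _ (by omega) hi hN, ih _ _ (by omega) hi (by omega)]
    · simp
    · intro τ; simp [pow_succ']
    · intro τ j
      rw [Nat.choose_succ_succ, Nat.add_sub_add_right]
      rcases lt_or_ge j d with hj | hj
      · rw [show d - j = d - (j + 1) + 1 by omega]; push_cast; ring
      · rw [Nat.choose_eq_zero_of_lt (show d < j + 1 by omega)]; simp

/-! ### Derivatives and smoothness of truncated powers -/

theorem hasDerivAt_truncPow (s : ℕ) (u : ℝ) (h : 1 ≤ s ∨ u ≠ 0) :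
    HasDerivAt (truncPow (s + 1)) ((s + 1) * truncPow s u) u := by
  rcases lt_trichotomy u 0 with hu | rfl | hu
  · have : truncPow (s + 1) =ᶠ[nhds u] fun _ => 0 := by
      filter_upwards [gt_mem_nhds hu] with v hv
      simp [truncPow, hv.le]
    simpa [truncPow, hu.not_gt] using (hasDerivAt_const u (0 : ℝ)).congr_of_eventuallyEq this
  · have hs : 1 ≤ s := by simpa using h
    have h0 : (s + 1 : ℝ) * truncPow s 0 = 0 := by simp [truncPow]
    rw [h0, hasDerivAt_iff_isLittleO_nhds_zero]
    have : (fun h : ℝ => h ^ (s + 1)) =o[nhds 0] fun h => h := by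
      simpa using Asymptotics.isLittleO_pow_pow (𝕜 := ℝ) (show 1 < s + 1 by omega)
    refine (Asymptotics.IsBigO.of_bound 1 (Filter.Eventually.of_forall fun v => ?_)).trans_isLittleO
      this
    by_cases hv : 0 < v <;> simp [truncPow, hv]
  · have : truncPow (s + 1) =ᶠ[nhds u] fun v => v ^ (s + 1) := by
      filter_upwards [lt_mem_nhds hu] with v hv
      simp [truncPow, hv]
    simpa [truncPow, hu] using (hasDerivAt_pow (s + 1) u).congr_of_eventuallyEq this

theorem iteratedDeriv_truncPow {p j : ℕ} (h : j < p) :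
    iteratedDeriv j (truncPow p) = fun u => (p.descFactorial j : ℝ) * truncPow (p - j) u := by
  induction j with
  | zero => simp
  | succ j ih =>
    rw [iteratedDeriv_succ, ih (by omega)]
    funext u
    obtain ⟨s, rfl⟩ : ∃ s, p = s + 1 + j := ⟨p - 1 - j, by omega⟩
    rw [show s + 1 + j - j = s + 1 by omega, show s + 1 + j - (j + 1) = s by omega,
      ((hasDerivAt_truncPow s u (Or.inl (by omega))).const_mul _).deriv, Nat.descFactorial_succ,
      show s + 1 + j - j = s + 1 by omega]
    push_cast; ring

/-- Away from the kink the top order `j = p` is allowed too: only the last differentiation can meet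
the jump. Knots of multiplicity m in B-splines of degree m-1 need this case. -/
theorem iteratedDeriv_truncPow_of_ne {p j : ℕ} (h : j ≤ p) {u : ℝ} (hu : u ≠ 0) :
    iteratedDeriv j (truncPow p) u = (p.descFactorial j : ℝ) * truncPow (p - j) u := by
  cases j with
  | zero => simp
  | succ j =>
    rw [iteratedDeriv_succ, iteratedDeriv_truncPow (by omega)]
    obtain ⟨s, rfl⟩ : ∃ s, p = s + 1 + j := ⟨p - 1 - j, by omega⟩
    rw [show s + 1 + j - j = s + 1 by omega, show s + 1 + j - (j + 1) = s by omega,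
      ((hasDerivAt_truncPow s u (Or.inr hu)).const_mul _).deriv, Nat.descFactorial_succ,
      show s + 1 + j - j = s + 1 by omega]
    push_cast; ring

theorem contDiff_truncPow {p j : ℕ} (h : j < p) : ContDiff ℝ j (truncPow p) := by
  induction j generalizing p with
  | zero =>
    obtain ⟨s, rfl⟩ : ∃ s, p = s + 1 := ⟨p - 1, by omega⟩
    rw [Nat.cast_zero, contDiff_zero]
    have : truncPow (s + 1) = fun u => max u 0 ^ (s + 1) := by
      funext u
      rcases lt_or_ge 0 u with hu | hu
      · simp [truncPow, hu, hu.le]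
      · simp [truncPow, hu, hu.not_gt]
    rw [this]; fun_prop
  | succ j ih =>
    obtain ⟨s, rfl⟩ : ∃ s, p = s + 1 := ⟨p - 1, by omega⟩
    have hd := fun u => hasDerivAt_truncPow s u (Or.inl (by omega))
    push_cast
    rw [contDiff_succ_iff_deriv]
    refine ⟨fun u => (hd u).differentiableAt, by simp, ?_⟩
    rw [show deriv (truncPow (s + 1)) = fun u => (s + 1 : ℝ) * truncPow s u from
      funext fun u => (hd u).deriv]
    exact contDiff_const.mul (ih (by omega))

theorem iteratedDeriv_truncPow_sub_div {p j : ℕ} (h : j < p) (x τ : ℝ) :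
    iteratedDeriv j (fun t => truncPow p (t - x)) τ / (j ! : ℝ) =
      (p.choose j : ℝ) * truncPow (p - j) (τ - x) := by
  have : (j ! : ℝ) ≠ 0 := by positivity
  rw [iteratedDeriv_comp_sub_const, iteratedDeriv_truncPow h,
    Nat.descFactorial_eq_factorial_mul_choose]
  push_cast
  field_simp

theorem iteratedDeriv_truncPow_sub_div_of_ne {p j : ℕ} (h : j ≤ p) {x τ : ℝ} (hx : τ ≠ x) :
    iteratedDeriv j (fun t => truncPow p (t - x)) τ / (j ! : ℝ) =
      (p.choose j : ℝ) * truncPow (p - j) (τ - x) := by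
  have : (j ! : ℝ) ≠ 0 := by positivity
  rw [iteratedDeriv_comp_sub_const]
  simp only []
  rw [iteratedDeriv_truncPow_of_ne h (sub_ne_zero.2 hx), Nat.descFactorial_eq_factorial_mul_choose]
  push_cast
  field_simp

/-! ### Newton interpolation and the truncated Marsden identity -/

open Polynomial in
/-- The Newton form, in the variable `X = · - y`, of the polynomial interpolating the data `F` at
the nodes `t i, …, t (i + r - 1)`. -/
noncomputable def newtonForm (F : ℝ → ℕ → ℝ) (t : ℕ → ℝ) (y : ℝ) (i r : ℕ) : ℝ[X] :=
  ∑ j ∈ range r, C (jetDividedDiff F t j i) * ∏ k ∈ range j, (X + C (y - t (i + k)))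

-- Interpolants on two consecutive windows of nodes agree at the shared nodes, so their difference
-- is the difference of leading coefficients times the nodal polynomial of these nodes.
open Polynomial in
theorem newtonForm_succ_sub_newtonForm (F : ℝ → ℕ → ℝ) {t : ℕ → ℝ} (y : ℝ) {N i : ℕ}
    (ht : MonotoneOn t (Set.Icc 1 N)) (hi : 1 ≤ i) (r : ℕ) (hN : i + r ≤ N) :
    newtonForm F t y (i + 1) (r + 1) - newtonForm F t y i (r + 1) =
      C (jetDividedDiff F t r (i + 1) - jetDividedDiff F t r i) *
        ∏ k ∈ range r, (X + C (y - t (i + 1 + k))) := by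
  induction r with
  | zero => simp [newtonForm]
  | succ r ih =>
    have e := sub_mul_jetDividedDiff F (r := r) ht hi hN
    have ih := ih (by omega)
    unfold newtonForm at ih ⊢
    rw [sum_range_succ, sum_range_succ (n := r + 1), add_sub_add_comm, ih, ← e,
      prod_range_succ (n := r), prod_range_succ' (n := r)]
    simp only [show ∀ k, t (i + (k + 1)) = t (i + 1 + k) from fun k => by congr 1; omega, add_zero, map_mul, map_sub]
    ring

-- The sum telescopes: each summand is the change of the interpolant when the window of m nodes
-- moves one step to the right.
open Polynomial in
theorem sum_jetDividedDiff_mul_prod (F : ℝ → ℕ → ℝ) {t : ℕ → ℝ} (y : ℝ) {N m l : ℕ} (hm : 1 ≤ m)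
    (ht : MonotoneOn t (Set.Icc 1 N)) (hl : 1 ≤ l) (hN : l + m ≤ N + 1) :
    ∑ k ∈ Ico 1 l, C ((t (k + m) - t k) * jetDividedDiff F t m k) *
        ∏ i ∈ Icc (k + 1) (k + m - 1), (X + C (y - t i)) =
      newtonForm F t y l m - newtonForm F t y 1 m := by
  induction l, hl using Nat.le_induction with
  | base => simp
  | succ l hl ih =>
    obtain ⟨r, rfl⟩ : ∃ r, m = r + 1 := ⟨m - 1, by omega⟩
    rw [sum_Ico_succ_top hl, ih (by omega), sub_mul_jetDividedDiff F ht hl (by omega),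
      show Icc (l + 1) (l + (r + 1) - 1) = Ico (l + 1) (l + 1 + r) by ext; simp; omega,
      prod_Ico_eq_prod_range, Nat.add_sub_cancel_left,
      ← newtonForm_succ_sub_newtonForm F y ht hl r (by omega)]
    ring

-- The first ν + 1 nodes equal `t l`, so the leading Newton terms are plain powers of X and all
-- terms after index ν are divisible by X^{ν+1}.
open Polynomial in
theorem coeff_newtonForm (F : ℝ → ℕ → ℝ) {t : ℕ → ℝ} {N m l ν : ℕ}
    (ht : MonotoneOn t (Set.Icc 1 N)) (hl : 1 ≤ l) (hN : l + ν ≤ N) (hν : ν < m)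
    (h : t l = t (l + ν)) : (newtonForm F t (t l) l m).coeff ν = F (t l) ν := by
  have heq : ∀ k ≤ ν, t (l + k) = t l := fun k hk =>
    eq_of_le_of_le_of_eq ht hl (by omega) (by omega) hN h
  have hX : ∀ j ≤ ν + 1, ∏ k ∈ range j, (X + C (t l - t (l + k))) = (X : ℝ[X]) ^ j := by
    intro j hj
    rw [prod_congr rfl (g := fun _ => X), prod_const, card_range]
    intro k hk
    rw [heq k (by have := mem_range.1 hk; omega)]
    simp
  rw [newtonForm, finsetSum_coeff, sum_eq_single_of_mem ν (mem_range.2 hν)]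
  · rw [hX ν (by omega), coeff_C_mul_X_pow, if_pos rfl, jetDividedDiff_of_eq F h]
  · intro j _ hj
    rcases lt_or_gt_of_ne hj with hj | hj
    · rw [hX j (by omega), coeff_C_mul_X_pow, if_neg (by omega)]
    · obtain ⟨i, rfl⟩ : ∃ i, j = ν + 1 + i := ⟨j - (ν + 1), by omega⟩
      rw [prod_range_add, hX _ le_rfl, coeff_C_mul, coeff_X_pow_mul', if_neg (by omega), mul_zero]

open Polynomial in
theorem newtonForm_eq_zero {F : ℝ → ℕ → ℝ} {t : ℕ → ℝ} (y : ℝ) {i m : ℕ}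
    (h : ∀ j < m, t (i + j) = t i) (hF : ∀ j < m, F (t i) j = 0) : newtonForm F t y i m = 0 := by
  refine sum_eq_zero fun j hj => ?_
  rw [jetDividedDiff_of_eq F (h j (mem_range.1 hj)).symm, hF j (mem_range.1 hj), C_0, zero_mul]

open Polynomial in
theorem coeff_prod_X_add_C (y : ℝ) (t : ℕ → ℝ) {m ν : ℕ} (k : ℕ) (hν : ν ≤ m - 1) :
    (∏ i ∈ Icc (k + 1) (k + m - 1), (X + C (y - t i))).coeff ν =
      ((Icc (k + 1) (k + m - 1)).val.map fun i => y - t i).esymm (m - 1 - ν) := by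
  have hc : ((Icc (k + 1) (k + m - 1)).val.map fun i => y - t i).card = m - 1 := by
    simp; omega
  have := Multiset.prod_X_add_C_coeff ((Icc (k + 1) (k + m - 1)).val.map fun i => y - t i)
    (k := ν) (by omega)
  rw [hc, Multiset.map_map] at this
  exact this

/-- The truncated form of Marsden's identity. -/
theorem sum_truncCoeff_mul_jetDividedDiff (F : ℝ → ℕ → ℝ) {t : ℕ → ℝ} {m n l ν : ℕ} (hm : 1 ≤ m)
    (ht : MonotoneOn t (Set.Icc 1 (n + m))) (hl : 1 ≤ l) (hln : l ≤ n) (hν : ν < m)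
    (h : t l = t (l + ν)) (ha : ∀ j < m, t (1 + j) = t 1) (hF : ∀ j < m, F (t 1) j = 0) :
    ∑ k ∈ Icc 1 n, truncCoeff m t l ν k * ((t (k + m) - t k) * jetDividedDiff F t m k) =
      F (t l) ν / ((m - 1).choose ν : ℝ) := by
  have key := congrArg (fun p => p.coeff ν / ((m - 1).choose ν : ℝ))
    (sum_jetDividedDiff_mul_prod F (t l) hm ht hl (by omega))
  simp only [newtonForm_eq_zero (t l) ha hF, sub_zero,
    coeff_newtonForm F ht hl (show l + ν ≤ n + m by omega) hν h, Polynomial.finsetSum_coeff,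
    sum_div, Polynomial.coeff_C_mul] at key
  rw [← key]
  symm
  refine sum_subset_zero_on_sdiff (fun k hk => ?_) (fun k hk => ?_) (fun k hk => ?_)
  · simp only [mem_Ico, mem_Icc] at hk ⊢; omega
  · simp only [mem_sdiff, mem_Ico, mem_Icc] at hk
    rw [truncCoeff, if_neg (by omega), zero_mul]
  · rw [truncCoeff]
    split_ifs with hk'
    · rw [coeff_prod_X_add_C _ _ _ (by omega)]; ring
    -- Here l - m + ν < k < l, so the nodes `t l, …, t (l + ν)` all occur in the product. It is
    -- divisible by X^{ν+1} and its coefficient at X^ν vanishes, which is why the coefficients may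
    -- be cut off there.
    · have hk := mem_Ico.1 hk
      have hsub : Icc l (l + ν) ⊆ Icc (k + 1) (k + m - 1) := Icc_subset_Icc (by omega) (by omega)
      rw [← prod_sdiff hsub, prod_congr (s₁ := Icc l (l + ν)) rfl (g := fun _ => Polynomial.X),
        prod_const, Nat.card_Icc, Polynomial.coeff_mul_X_pow', if_neg (by omega)]
      · simp
      · intro i hi
        have hi := mem_Icc.1 hi
        rw [eq_of_le_of_le_of_eq ht hl hi.1 hi.2 (by omega) h]
        simp

/-! ### Raising the order with the difference matrices -/

/-- A column of `diffProd` turns the B-splines of order `m` into multiples of divided differences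
of higher order. -/
theorem sum_jetDividedDiff_mul_diffProd (F : ℝ → ℕ → ℝ) {t : ℕ → ℝ} {m n : ℕ} (hm : 1 ≤ m)
    (ht : MonotoneOn t (Set.Icc 1 (n + m)))
    (hlt : ∀ i, 1 ≤ i → i + m ≤ n + m → t i < t (i + m)) (r : ℕ) (hr : r ≤ n)
    (k : Fin (n - r)) :
    ∑ j : Fin n, ((t (j + 1 + m) - t (j + 1)) * jetDividedDiff F t m (j + 1)) *
        diffProd m n t r j k =
      (-1) ^ r * ((m + r - 1)! / (m - 1)! : ℝ) *
        ((t (k + 1 + (m + r)) - t (k + 1)) * jetDividedDiff F t (m + r) (k + 1)) := by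
  induction r with
  | zero =>
    have : ((m - 1)! : ℝ) ≠ 0 := by positivity
    simp [diffProd, Matrix.one_apply, this]
  | succ r ih =>
    have ih := ih (by omega)
    have hk := k.2
    let k₀ : Fin (n - r) := ⟨k, by omega⟩
    let k₁ : Fin (n - r) := ⟨k + 1, by omega⟩
    have hD : ∀ j : Fin n, diffProd m n t (r + 1) j k =
        diffProd m n t r j k₀ * (knotSpan t (m + r) (k + 1))⁻¹ -
        diffProd m n t r j k₁ * (knotSpan t (m + r) (k + 1 + 1))⁻¹ := by
      intro j
      rw [diffProd, Matrix.mul_apply]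
      simp only [Matrix.transpose_apply, diffMatrix, Matrix.mul_diagonal, bidiag, Matrix.of_apply]
      rw [← sum_subset (subset_univ {k₀, k₁}), sum_pair]
      · simp [k₀, k₁]; ring
      · simp [k₀, k₁]
      · intro x _ hx
        have h0 : (x : ℕ) ≠ k := fun h => hx (by simp [k₀, ← h])
        have h1 : (x : ℕ) ≠ k + 1 := fun h => hx (by simp [k₁, ← h])
        simp [h0, h1]
    have hpos : ∀ i, 1 ≤ i → i + (m + r) ≤ n + m → t (i + (m + r)) - t i ≠ 0 := by
      intro i h1 h2
      have := hlt i h1 (by omega)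
      have := ht (a := i + m) (b := i + (m + r)) ⟨by omega, by omega⟩ ⟨by omega, h2⟩ (by omega)
      exact ne_of_gt (by linarith)
    have hS : ∀ (A B : Fin n → ℝ) (S : Fin n → ℝ) (u v : ℝ), ∑ j, S j * (A j * u - B j * v) =
        (∑ j, S j * A j) * u - (∑ j, S j * B j) * v := by
      intro A B S u v
      rw [sum_mul, sum_mul, ← sum_sub_distrib]
      exact sum_congr rfl fun j _ => by ring
    simp only [hD]
    rw [hS]
    have e0 := ih k₀
    have e1 := ih k₁
    have p0 := hpos (k + 1) (by omega) (by omega)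
    have p1 := hpos (k + 1 + 1) (by omega) (by omega)
    -- The inverse knot spans cancel the differences of knots and leave a factor m + r; the row (1,
    -- -1) then gives minus the numerator of the recursion, hence the sign (-1)^r.
    have hrec := sub_mul_jetDividedDiff F (r := m + r) (i := k + 1) ht (by omega) (by omega)
    have hmr : ((m + r : ℕ) : ℝ) ≠ 0 := by norm_cast; omega
    have hf : ((m + (r + 1) - 1)! : ℝ) = (m + r : ℕ) * (m + r - 1)! := by
      rw [show m + (r + 1) - 1 = m + r by omega, ← Nat.mul_factorial_pred (n := m + r) (by omega)]
      push_cast; ring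
    rw [e0, e1, hf, show m + (r + 1) = m + r + 1 by omega]
    simp only [k₀, k₁, knotSpan]
    rw [hrec]
    have : ((m - 1)! : ℝ) ≠ 0 := by positivity
    field_simp
    ring

/-! ### Integrals of products of truncated powers -/

/-- A Beta integral: integration by parts shifts one power from x - u to t - x, and both boundary
terms vanish. -/
theorem integral_sub_pow_mul_sub_pow (u t : ℝ) (i s : ℕ) :
    ∫ x in u..t, (x - u) ^ i * (t - x) ^ s =
      (i ! * s ! / (i + s + 1)! : ℝ) * (t - u) ^ (i + s + 1) := by
  induction i generalizing s with
  | zero =>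
    have := intervalIntegral.integral_comp_sub_left (fun x : ℝ => x ^ s) (a := u) (b := t) t
    simp only [pow_zero, one_mul]
    rw [this, integral_pow]
    have : (s ! : ℝ) ≠ 0 := by positivity
    have : (s + 1 : ℝ) ≠ 0 := by positivity
    rw [zero_add, Nat.factorial_succ]
    simp
    field_simp
  | succ i ih =>
    have hs : (s + 1 : ℝ) ≠ 0 := by positivity
    have hd : ∀ x : ℝ, HasDerivAt (fun x => -(t - x) ^ (s + 1) / (s + 1 : ℝ)) ((t - x) ^ s) x := by
      intro x
      have := ((((hasDerivAt_id x).const_sub t).pow (s + 1)).neg).div_const (s + 1 : ℝ)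
      refine this.congr_deriv ?_
      simp
      field_simp
    have hd' : ∀ x : ℝ, HasDerivAt (fun x => (x - u) ^ (i + 1)) ((i + 1) * (x - u) ^ i) x := by
      intro x
      exact (((hasDerivAt_id x).sub_const u).pow (i + 1)).congr_deriv (by simp)
    rw [intervalIntegral.integral_mul_deriv_eq_deriv_mul (fun x _ => hd' x) (fun x _ => hd x)
      (Continuous.intervalIntegrable (by fun_prop) _ _)
      (Continuous.intervalIntegrable (by fun_prop) _ _)]
    have : ∀ x : ℝ, (i + 1) * (x - u) ^ i * (-(t - x) ^ (s + 1) / (s + 1 : ℝ)) =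
        -((i + 1) / (s + 1 : ℝ)) * ((x - u) ^ i * (t - x) ^ (s + 1)) := fun x => by ring
    simp only [this]
    rw [intervalIntegral.integral_const_mul, ih, show i + (s + 1) + 1 = i + 1 + s + 1 by omega,
      Nat.factorial_succ s, Nat.factorial_succ i]
    push_cast
    simp
    field_simp

/-- Expanding y - x around a exhibits the integral as a polynomial in τ - a, ready to be
annihilated. -/
theorem integral_sub_pow_mul_sub_pow_eq_sum (a y τ : ℝ) (q s : ℕ) :
    ∫ x in a..τ, (y - x) ^ q * (τ - x) ^ s =
      ∑ i ∈ range (q + 1), (q.choose i * (-1) ^ i * (y - a) ^ (q - i) : ℝ) *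
        ((i ! * s ! / (i + s + 1)! : ℝ) * (τ - a) ^ (i + s + 1)) := by
  have : ∀ x : ℝ, (y - x) ^ q * (τ - x) ^ s =
      ∑ i ∈ range (q + 1), (q.choose i * (-1) ^ i * (y - a) ^ (q - i) : ℝ) *
        ((x - a) ^ i * (τ - x) ^ s) := by
    intro x
    rw [show y - x = -(x - a) + (y - a) by ring, add_pow, sum_mul]
    refine sum_congr rfl fun i _ => ?_
    rw [neg_pow]; ring
  simp only [this]
  rw [intervalIntegral.integral_finsetSum
    fun i _ => Continuous.intervalIntegrable (by fun_prop) _ _]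
  simp only [intervalIntegral.integral_const_mul, integral_sub_pow_mul_sub_pow]

theorem truncPow_nonneg (r : ℕ) (s : ℝ) : 0 ≤ truncPow r s := by
  unfold truncPow; split_ifs <;> positivity

theorem monotone_truncPow (r : ℕ) : Monotone (truncPow r) := by
  intro u v h
  by_cases hu : 0 < u
  · simp only [truncPow, hu, hu.trans_le h, if_true]; gcongr
  · simpa [truncPow, hu] using truncPow_nonneg r v

theorem intervalIntegrable_truncPow_mul_truncPow (q s : ℕ) (y τ a b : ℝ) :
    IntervalIntegrable (fun x => truncPow q (y - x) * truncPow s (τ - x))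
      MeasureTheory.volume a b := by
  -- Both factors are nonnegative and decreasing in x, hence so is the product.
  refine Antitone.intervalIntegrable fun u v h => ?_
  exact mul_le_mul (monotone_truncPow q (by linarith)) (monotone_truncPow s (by linarith))
    (truncPow_nonneg _ _) (truncPow_nonneg _ _)

/-- The integrand lives on x < min y τ. If y < τ, stopping at y instead of τ drops a Beta integral
over [y, τ]; if τ ≤ y, nothing is dropped and the truncated power is zero. -/
theorem integral_truncPow_mul_truncPow {a b y τ : ℝ} (ha : a ≤ y) (hyb : y ≤ b) (haτ : a ≤ τ)
    (q s : ℕ) :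
    ∫ x in a..b, truncPow q (y - x) * truncPow s (τ - x) =
      (∫ x in a..τ, (y - x) ^ q * (τ - x) ^ s) -
        (-1) ^ q * ((q ! * s ! / (q + s + 1)! : ℝ) * truncPow (q + s + 1) (τ - y)) := by
  have hi := intervalIntegrable_truncPow_mul_truncPow q s y τ
  have hz : a ≤ min y τ := le_min ha haτ
  have hzb : min y τ ≤ b := (min_le_left _ _).trans hyb
  have h1 : ∫ x in a..(min y τ), truncPow q (y - x) * truncPow s (τ - x) =
      ∫ x in a..(min y τ), (y - x) ^ q * (τ - x) ^ s := by
    refine intervalIntegral.integral_congr_ae ?_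
    filter_upwards [(Set.countable_singleton (min y τ)).ae_notMem MeasureTheory.volume] with x hx hx'
    rw [Set.uIoc_of_le hz] at hx'
    have hlt := lt_of_le_of_ne hx'.2 hx
    rw [lt_min_iff] at hlt
    simp [truncPow, hlt.1, hlt.2]
  have h2 : ∫ x in (min y τ)..b, truncPow q (y - x) * truncPow s (τ - x) = 0 := by
    rw [intervalIntegral.integral_congr_ae (g := fun _ => 0), intervalIntegral.integral_zero]
    refine Filter.Eventually.of_forall fun x hx => ?_
    rw [Set.uIoc_of_le hzb, Set.mem_Ioc, min_lt_iff] at hx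
    rcases hx.1 with h | h
    · simp [truncPow, h.le.not_gt]
    · simp [truncPow, h.le.not_gt]
  rw [← intervalIntegral.integral_add_adjacent_intervals (hi a (min y τ)) (hi (min y τ) b), h1, h2,
    add_zero]
  rcases le_or_gt τ y with h | h
  · simp [min_eq_right h, truncPow, h.not_gt]
  · have hc : ∀ u v : ℝ, IntervalIntegrable (fun x => (y - x) ^ q * (τ - x) ^ s)
        MeasureTheory.volume u v := fun u v => Continuous.intervalIntegrable (by fun_prop) _ _
    rw [min_eq_left h.le, ← intervalIntegral.integral_add_adjacent_intervals (hc a y) (hc y τ)]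
    have : ∀ x : ℝ, (y - x) ^ q * (τ - x) ^ s = (-1) ^ q * ((x - y) ^ q * (τ - x) ^ s) := by
      intro x; rw [← neg_sub x y, neg_pow]; ring
    have e : ∫ x in y..τ, (y - x) ^ q * (τ - x) ^ s =
        (-1) ^ q * ((q ! * s ! / (q + s + 1)! : ℝ) * truncPow (q + s + 1) (τ - y)) := by
      simp only [this]
      rw [intervalIntegral.integral_const_mul, integral_sub_pow_mul_sub_pow]
      simp [truncPow, h]
    rw [e]; ring

/-! ### Knot multiplicities, factorial identities and finite sums -/

theorem IsOpenKnotVector.lt_add {m n : ℕ} {a b : ℝ} {θ : ℕ → ℝ} (hθ : IsOpenKnotVector m n a b θ)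
    (i : ℕ) (hi : 1 ≤ i) (hin : i + m ≤ n + m) : θ i < θ (i + m) := by
  by_contra h
  have heq : θ i = θ (i + m) := le_antisymm
    (hθ.mono ⟨hi, by omega⟩ ⟨by omega, hin⟩ (by omega)) (not_lt.1 h)
  have hsub : Icc i (i + m) ⊆ (Icc 1 (n + m)).filter (fun j => θ j = θ i) := by
    intro j hj
    have hj := mem_Icc.1 hj
    exact mem_filter.2 ⟨mem_Icc.2 ⟨by omega, by omega⟩,
      eq_of_le_of_le_of_eq hθ.mono hi hj.1 hj.2 hin heq⟩
  have h1 := card_le_card hsub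
  have h2 := hθ.mult_le (θ i)
  rw [Nat.card_Icc] at h1
  unfold knotMult at h2
  omega

theorem eq_add_of_lt_knotMult {θ : ℕ → ℝ} {N l ν : ℕ} (hmono : MonotoneOn θ (Set.Icc 1 N))
    (hl : 2 ≤ l) (hlN : l ≤ N) (hfirst : θ (l - 1) < θ l) (hν : ν < knotMult θ N (θ l)) :
    l + ν ≤ N ∧ θ l = θ (l + ν) := by
  have hge : ∀ j ∈ (Icc 1 N).filter (fun j => θ j = θ l), l ≤ j ∧ j ≤ N := by
    intro j hj
    simp only [mem_filter, mem_Icc] at hj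
    refine ⟨?_, hj.1.2⟩
    by_contra hlt
    have := hmono (a := j) (b := l - 1) hj.1 ⟨by omega, by omega⟩ (by omega)
    linarith [hj.2]
  unfold knotMult at hν
  have hN : l + ν ≤ N := by
    have := card_le_card (t := Icc l N) fun j hj => mem_Icc.2 (hge j hj)
    rw [Nat.card_Icc] at this
    omega
  refine ⟨hN, ?_⟩
  by_contra hne
  have hsub : (Icc 1 N).filter (fun j => θ j = θ l) ⊆ Ico l (l + ν) := by
    intro j hj
    have h1 := hge j hj
    simp only [mem_filter, mem_Icc] at hj
    refine mem_Ico.2 ⟨h1.1, ?_⟩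
    by_contra hlt
    exact hne (eq_of_le_of_le_of_eq (j := l + ν) hmono (by omega) (by omega) (by omega) h1.2
      hj.2.symm).symm
  have := card_le_card hsub
  rw [Nat.card_Ico] at this
  omega

theorem bspline_eq_jetDividedDiff (θ : ℕ → ℝ) (p k : ℕ) (x : ℝ) :
    bspline θ p k x = (θ (k + p) - θ k) * jetDividedDiff
      (fun τ j => iteratedDeriv j (fun t => truncPow (p - 1) (t - x)) τ / (j ! : ℝ)) θ p k := by
  rw [bspline, dividedDiff_eq_jetDividedDiff]

theorem sum_Icc_one_eq_sum_fin (n : ℕ) (f : ℕ → ℝ) :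
    ∑ k ∈ Icc 1 n, f k = ∑ k : Fin n, f (k + 1) := by
  rw [← sum_range fun k => f (k + 1), range_eq_Ico, sum_Ico_add' f 0 n 1]
  rfl

/-- Makes the Beta constants compatible with Taylor coefficients: integrating those of a power of
degree m-1 gives those of one of degree i + m, up to a factor independent of j. -/
theorem choose_mul_factorial_div {m j : ℕ} (hj : j < m) (i : ℕ) :
    ((m - 1).choose j : ℝ) * (i ! * (m - 1 - j)! / (i + (m - 1 - j) + 1)!) =
      i ! * (m - 1)! / (i + m)! * ((i + m).choose j : ℝ) := by
  rw [Nat.cast_choose ℝ (show j ≤ m - 1 by omega), Nat.cast_choose ℝ (show j ≤ i + m by omega),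
    show i + (m - 1 - j) + 1 = i + m - j by omega]
  field_simp

/-- The analogue for differentiating in x: the factor in front of the Taylor coefficients of degree
N - ν does not depend on j. -/
theorem choose_mul_descFactorial {N j ν : ℕ} (h : j + ν ≤ N) :
    (N.choose j : ℝ) * ((N - j).descFactorial ν : ℝ) =
      N ! / (N - ν)! * ((N - ν).choose j : ℝ) := by
  have e := Nat.factorial_mul_descFactorial (show ν ≤ N - j by omega)
  have e' : ((N - j).descFactorial ν : ℝ) = (N - j)! / (N - j - ν)! := by
    rw [eq_div_iff (by positivity), ← e]; push_cast; ring
  rw [e', Nat.cast_choose ℝ (show j ≤ N by omega), Nat.cast_choose ℝ (show j ≤ N - ν by omega),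
    show N - ν - j = N - j - ν by omega]
  field_simp

theorem iteratedDeriv_truncPow_const_sub {p ν : ℕ} (h : ν < p) (τ x : ℝ) :
    iteratedDeriv ν (fun x => truncPow p (τ - x)) x =
      (-1) ^ ν * ((p.descFactorial ν : ℝ) * truncPow (p - ν) (τ - x)) := by
  rw [iteratedDeriv_comp_const_sub, iteratedDeriv_truncPow h]
  simp only [smul_eq_mul]

theorem contDiff_truncPow_const_sub {p ν : ℕ} (h : ν < p) (τ : ℝ) :
    ContDiff ℝ ν (fun x => truncPow p (τ - x)) :=
  (contDiff_truncPow h).comp (contDiff_const.sub contDiff_id)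

theorem intervalIntegrable_sum_sum {ι κ : Type*} {s : Finset ι} {t : Finset κ}
    {f : ι → κ → ℝ → ℝ} {a b : ℝ}
    (h : ∀ i ∈ s, ∀ j ∈ t, IntervalIntegrable (f i j) MeasureTheory.volume a b) :
    IntervalIntegrable (fun x => ∑ i ∈ s, ∑ j ∈ t, f i j x) MeasureTheory.volume a b := by
  have := IntervalIntegrable.sum s fun i hi => IntervalIntegrable.sum t (h i hi)
  rwa [show (∑ i ∈ s, ∑ j ∈ t, f i j) = fun x => ∑ i ∈ s, ∑ j ∈ t, f i j x from
    funext fun x => by simp] at this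

theorem integral_sum_sum {ι κ : Type*} {s : Finset ι} {t : Finset κ} {f : ι → κ → ℝ → ℝ} {a b : ℝ}
    (h : ∀ i ∈ s, ∀ j ∈ t, IntervalIntegrable (f i j) MeasureTheory.volume a b) :
    ∫ x in a..b, ∑ i ∈ s, ∑ j ∈ t, f i j x = ∑ i ∈ s, ∑ j ∈ t, ∫ x in a..b, f i j x := by
  simp only [← sum_product']
  exact intervalIntegral.integral_finsetSum fun p hp =>
    h p.1 (mem_product.1 hp).1 p.2 (mem_product.1 hp).2

/-! ### B-splines as combinations of truncated powers -/

section MainTheorem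

variable {m n : ℕ} {a b : ℝ} {θ : ℕ → ℝ}

theorem ae_forall_knot_ne (θ : ℕ → ℝ) (N : ℕ) : ∀ᵐ x : ℝ, ∀ k ∈ Icc 1 N, θ k ≠ x := by
  filter_upwards [((Icc 1 N).image θ).countable_toSet.ae_notMem MeasureTheory.volume] with x hx k hk h
  exact hx (by simpa using ⟨k, mem_Icc.1 hk, h⟩)

theorem IsOpenKnotVector.mem_Icc (hθ : IsOpenKnotVector m n a b θ) (hm : 1 ≤ m) {k : ℕ}
    (hk : k ∈ Icc 1 (n + m)) : a ≤ θ k ∧ θ k ≤ b := by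
  have hk := Finset.mem_Icc.1 hk
  constructor
  · rw [← hθ.left 1 ⟨le_rfl, hm⟩]
    exact hθ.mono ⟨le_rfl, by omega⟩ hk hk.1
  · rw [← hθ.right (n + m) ⟨by omega, le_rfl⟩]
    exact hθ.mono hk ⟨by omega, le_rfl⟩ hk.2

/-- A divided difference of truncated powers of degree `m - 1`, away from the knots. -/
theorem jetDividedDiff_truncPow_eq_sum {w : ℕ → ℕ → ℝ} {N M r i : ℕ}
    (hw : ∀ F : ℝ → ℕ → ℝ,
      jetDividedDiff F θ r i = ∑ k ∈ Icc 1 N, ∑ j ∈ range M, w k j * F (θ k) j) {x : ℝ}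
    (hx : ∀ k ∈ Icc 1 N, θ k ≠ x) :
    jetDividedDiff
      (fun τ j => iteratedDeriv j (fun t => truncPow (M - 1) (t - x)) τ / (j ! : ℝ)) θ r i =
      ∑ k ∈ Icc 1 N, ∑ j ∈ range M,
        w k j * (((M - 1).choose j : ℝ) * truncPow (M - 1 - j) (θ k - x)) := by
  rw [hw]
  refine sum_congr rfl fun k hk => sum_congr rfl fun j hj => ?_
  rw [iteratedDeriv_truncPow_sub_div_of_ne (by have := mem_range.1 hj; omega) (hx k hk)]

theorem IsOpenKnotVector.intervalIntegrable_bspline_mul_bspline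
    (hθ : IsOpenKnotVector m n a b θ) (hm : 1 ≤ m) (i j : Fin n) :
    IntervalIntegrable (fun x => bspline θ m (i + 1) x * bspline θ m (j + 1) x)
      MeasureTheory.volume a b := by
  obtain ⟨w₁, h₁⟩ := exists_weights_jetDividedDiff hθ.mono hm hθ.lt_add m (i + 1) (by omega)
    (by omega)
  obtain ⟨w₂, h₂⟩ := exists_weights_jetDividedDiff hθ.mono hm hθ.lt_add m (j + 1) (by omega)
    (by omega)
  have key : IntervalIntegrable (fun x =>
      ((θ (i + 1 + m) - θ (i + 1)) * ∑ k ∈ Icc 1 (n + m), ∑ j ∈ range m,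
        w₁ k j * (((m - 1).choose j : ℝ) * truncPow (m - 1 - j) (θ k - x))) *
      ((θ (j + 1 + m) - θ (j + 1)) * ∑ k ∈ Icc 1 (n + m), ∑ j ∈ range m,
        w₂ k j * (((m - 1).choose j : ℝ) * truncPow (m - 1 - j) (θ k - x))))
      MeasureTheory.volume a b := by
    simp only [mul_sum, sum_mul]
    refine intervalIntegrable_sum_sum fun k _ l _ => intervalIntegrable_sum_sum fun k' _ l' _ => ?_
    convert (intervalIntegrable_truncPow_mul_truncPow (m - 1 - l') (m - 1 - l) (θ k') (θ k)
      a b).const_mul ((θ (i + 1 + m) - θ (i + 1)) * (w₁ k' l' * (m - 1).choose l') *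
        ((θ (j + 1 + m) - θ (j + 1)) * (w₂ k l * (m - 1).choose l))) using 1
    funext x
    ring
  refine key.congr_ae ?_
  refine MeasureTheory.ae_restrict_of_ae ?_
  filter_upwards [ae_forall_knot_ne θ (n + m)] with x hx
  rw [bspline_eq_jetDividedDiff, bspline_eq_jetDividedDiff, jetDividedDiff_truncPow_eq_sum h₁ hx,
    jetDividedDiff_truncPow_eq_sum h₂ hx]

theorem IsOpenKnotVector.sum_truncCoeff_mul_bspline (hθ : IsOpenKnotVector m n a b θ) (hm : 1 ≤ m)
    {l ν : ℕ} (hl : 1 ≤ l) (hln : l ≤ n) (hν : ν < m) (h : θ l = θ (l + ν)) {x : ℝ} (hax : a < x)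
    (hx : θ l ≠ x) :
    ∑ k : Fin n, truncCoeffVec m n θ l ν k * bspline θ m (k + 1) x =
      truncPow (m - 1 - ν) (θ l - x) := by
  have h1 : θ 1 = a := hθ.left 1 ⟨le_rfl, hm⟩
  have := sum_truncCoeff_mul_jetDividedDiff
    (fun τ j => iteratedDeriv j (fun t => truncPow (m - 1) (t - x)) τ / (j ! : ℝ)) hm hθ.mono hl hln
    -- Since a < x, all Taylor coefficients of (· - x)_+^{m-1} vanish at the m-fold knot a, which
    -- removes the Newton form at the left end.
    hν h (fun j hj => by rw [h1]; exact hθ.left _ ⟨by omega, by omega⟩) (fun j hj => by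
      rw [iteratedDeriv_truncPow_sub_div_of_ne (by omega) (h1 ▸ hax.ne), h1]
      simp [truncPow, hax.le.not_gt])
  rw [iteratedDeriv_truncPow_sub_div_of_ne (by omega) hx, sum_Icc_one_eq_sum_fin,
    mul_div_cancel_left₀] at this
  · simpa only [truncCoeffVec, bspline_eq_jetDividedDiff] using this
  · exact_mod_cast (Nat.choose_pos (by omega)).ne'

theorem IsOpenKnotVector.sum_bspline_mul_diffProd (hθ : IsOpenKnotVector m n a b θ) (hm : 1 ≤ m)
    (hmn : m ≤ n) {k : Fin (n - m)} {w : ℕ → ℕ → ℝ}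
    (hw : ∀ F : ℝ → ℕ → ℝ, jetDividedDiff F θ (m + m) (k + 1) =
      ∑ i ∈ Icc 1 (n + m), ∑ j ∈ range m, w i j * F (θ i) j)
    {x : ℝ} (hx : ∀ i ∈ Icc 1 (n + m), θ i ≠ x) :
    ∑ j : Fin n, bspline θ m (j + 1) x * diffProd m n θ m j k =
      (-1) ^ m * ((m + m - 1)! / (m - 1)! : ℝ) * ((θ (k + 1 + (m + m)) - θ (k + 1)) *
        ∑ i ∈ Icc 1 (n + m), ∑ j ∈ range m,
          w i j * (((m - 1).choose j : ℝ) * truncPow (m - 1 - j) (θ i - x))) := by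
  simp only [bspline_eq_jetDividedDiff]
  rw [sum_jetDividedDiff_mul_diffProd _ hm hθ.mono hθ.lt_add m hmn k,
    jetDividedDiff_truncPow_eq_sum hw hx]

/-- The integrals of the product of two truncated powers are, up to a factor and a term that is
annihilated by divided differences, Taylor coefficients of a truncated power. -/
theorem sum_weights_mul_integral_truncPow (ht : MonotoneOn θ (Set.Icc 1 (n + m))) {k q : ℕ}
    (hk : 1 ≤ k) (hkn : k + (m + m) ≤ n + m) (hq : q < m)
    {w : ℕ → ℕ → ℝ} (hw : ∀ F : ℝ → ℕ → ℝ, jetDividedDiff F θ (m + m) k =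
      ∑ i ∈ Icc 1 (n + m), ∑ j ∈ range m, w i j * F (θ i) j)
    {y : ℝ} (hay : a ≤ y) (hyb : y ≤ b) (haθ : ∀ i ∈ Icc 1 (n + m), a ≤ θ i) :
    ∑ i ∈ Icc 1 (n + m), ∑ j ∈ range m, w i j * (((m - 1).choose j : ℝ) *
        ∫ x in a..b, truncPow q (y - x) * truncPow (m - 1 - j) (θ i - x)) =
      (-1) ^ (q + 1) * (q ! * (m - 1)! / (q + m)! : ℝ) * ∑ i ∈ Icc 1 (n + m), ∑ j ∈ range m,
        w i j * (((q + m).choose j : ℝ) * truncPow (q + m - j) (θ i - y)) := by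
  have hpoly : ∀ d < m + m, ∑ i ∈ Icc 1 (n + m), ∑ j ∈ range m,
      w i j * ((d.choose j : ℝ) * (θ i - a) ^ (d - j)) = 0 := by
    intro d hd
    rw [← hw fun τ j => (d.choose j : ℝ) * (τ - a) ^ (d - j)]
    exact jetDividedDiff_pow_eq_zero a ht d _ _ hd hk hkn
  have hterm : ∀ i ∈ Icc 1 (n + m), ∀ j ∈ range m, w i j * (((m - 1).choose j : ℝ) *
        ∫ x in a..b, truncPow q (y - x) * truncPow (m - 1 - j) (θ i - x)) =
      (∑ d ∈ range (q + 1), (q.choose d * (-1) ^ d * (y - a) ^ (q - d) : ℝ) *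
        (d ! * (m - 1)! / (d + m)! : ℝ) *
          (w i j * (((d + m).choose j : ℝ) * (θ i - a) ^ (d + m - j)))) +
      (-1) ^ (q + 1) * (q ! * (m - 1)! / (q + m)! : ℝ) *
        (w i j * (((q + m).choose j : ℝ) * truncPow (q + m - j) (θ i - y))) := by
    intro i hi j hj
    have hj := mem_range.1 hj
    rw [integral_truncPow_mul_truncPow hay hyb (haθ i hi), integral_sub_pow_mul_sub_pow_eq_sum,
      mul_sub, mul_sub, sub_eq_add_neg, mul_sum, mul_sum]
    congr 1
    · refine sum_congr rfl fun d _ => ?_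
      have := choose_mul_factorial_div hj d
      rw [show d + m - j = d + (m - 1 - j) + 1 by omega]
      linear_combination (q.choose d * (-1) ^ d * (y - a) ^ (q - d) : ℝ) * w i j *
        (θ i - a) ^ (d + (m - 1 - j) + 1) * this
    · have := choose_mul_factorial_div hj q
      rw [show q + m - j = q + (m - 1 - j) + 1 by omega]
      linear_combination (-1) ^ (q + 1) * w i j * truncPow (q + (m - 1 - j) + 1) (θ i - y) * this
  rw [sum_congr rfl fun i hi => sum_congr rfl fun j hj => hterm i hi j hj]
  simp only [sum_add_distrib, ← mul_sum]
  -- With d outermost, each inner sum is a divided difference of order 2m of a polynomial of degree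
  -- d + m ≤ q + m < 2m.
  rw [add_eq_right, sum_congr rfl fun i _ => sum_comm, sum_comm]
  refine sum_eq_zero fun d hd => ?_
  simp only [← mul_sum]
  rw [hpoly (d + m) (by have := mem_range.1 hd; omega), mul_zero]

/-- Valid at every x, knots included: only derivatives of order j < m ≤ 2m - 1 occur. -/
theorem bspline_two_mul_eq_sum (hm : 1 ≤ m) {N k : ℕ}
    {w : ℕ → ℕ → ℝ} (hw : ∀ F : ℝ → ℕ → ℝ, jetDividedDiff F θ (m + m) k =
      ∑ i ∈ Icc 1 N, ∑ j ∈ range m, w i j * F (θ i) j) :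
    bspline θ (2 * m) k = fun x => (θ (k + (m + m)) - θ k) *
      ∑ i ∈ Icc 1 N, ∑ j ∈ range m,
        w i j * (((m + m - 1).choose j : ℝ) * truncPow (m + m - 1 - j) (θ i - x)) := by
  funext x
  rw [two_mul, bspline_eq_jetDividedDiff, hw]
  congr 1
  refine sum_congr rfl fun i _ => sum_congr rfl fun j hj => ?_
  rw [iteratedDeriv_truncPow_sub_div (by have := mem_range.1 hj; omega)]

theorem contDiff_bspline_two_mul (hm : 1 ≤ m) {N k ν : ℕ} (hν : ν < m)
    {w : ℕ → ℕ → ℝ} (hw : ∀ F : ℝ → ℕ → ℝ, jetDividedDiff F θ (m + m) k =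
      ∑ i ∈ Icc 1 N, ∑ j ∈ range m, w i j * F (θ i) j) :
    ContDiff ℝ ν (bspline θ (2 * m) k) := by
  rw [bspline_two_mul_eq_sum hm hw]
  -- All exponents 2m - 1 - j are at least m > ν.
  refine contDiff_const.mul (ContDiff.sum fun i _ => ContDiff.sum fun j hj =>
    contDiff_const.mul (contDiff_const.mul (contDiff_truncPow_const_sub ?_ _)))
  have := mem_range.1 hj; omega

theorem iteratedDeriv_bspline_two_mul (hm : 1 ≤ m) {N k ν : ℕ} (hν : ν < m)
    {w : ℕ → ℕ → ℝ} (hw : ∀ F : ℝ → ℕ → ℝ, jetDividedDiff F θ (m + m) k =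
      ∑ i ∈ Icc 1 N, ∑ j ∈ range m, w i j * F (θ i) j) (y : ℝ) :
    iteratedDeriv ν (bspline θ (2 * m) k) y =
      (θ (k + (m + m)) - θ k) * ((-1) ^ ν * ((m + m - 1)! / (m + m - 1 - ν)! : ℝ) *
        ∑ i ∈ Icc 1 N, ∑ j ∈ range m,
          w i j * (((m + m - 1 - ν).choose j : ℝ) * truncPow (m + m - 1 - ν - j) (θ i - y))) := by
  have hc : ∀ i, ∀ j ∈ range m, ContDiff ℝ ν fun x =>
      w i j * (((m + m - 1).choose j : ℝ) * truncPow (m + m - 1 - j) (θ i - x)) := fun i j hj =>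
    contDiff_const.mul (contDiff_const.mul
      (contDiff_truncPow_const_sub (by have := mem_range.1 hj; omega) _))
  rw [bspline_two_mul_eq_sum hm hw, iteratedDeriv_const_mul_field,
    iteratedDeriv_fun_sum fun i _ => (ContDiff.sum (hc i)).contDiffAt]
  simp only [mul_sum]
  refine sum_congr rfl fun i _ => ?_
  rw [iteratedDeriv_fun_sum fun j hj => (hc i j hj).contDiffAt, mul_sum]
  refine sum_congr rfl fun j hj => ?_
  have hj := mem_range.1 hj
  have e := choose_mul_descFactorial (show j + ν ≤ m + m - 1 by omega)
  rw [iteratedDeriv_const_mul_field, iteratedDeriv_const_mul_field,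
    iteratedDeriv_truncPow_const_sub (by omega),
    show m + m - 1 - j - ν = m + m - 1 - ν - j by omega]
  linear_combination (θ (k + (m + m)) - θ k) * w i j * (-1) ^ ν *
    truncPow (m + m - 1 - ν - j) (θ i - y) * e

end MainTheorem

/-! ### Assembling the identity -/

theorem mainTheorem5 (m n : ℕ) (hm : 1 ≤ m) (a b : ℝ) (θ : ℕ → ℝ)
    (hθ : IsOpenKnotVector m n a b θ)
    (ℓ : ℕ) (hℓ : m + 1 ≤ ℓ) (hℓn : ℓ ≤ n) (hfirst : θ (ℓ - 1) < θ ℓ)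
    (μ : ℕ) (hμ : μ = knotMult θ (n + m) (θ ℓ)) (ν : ℕ) (hν : ν ≤ μ - 1) :
    (∀ k : Fin (n - m), ContDiffAt ℝ ν (bspline θ (2 * m) (k + 1)) (θ ℓ)) ∧
    truncCoeffVec m n θ ℓ ν ᵥ* (gramMatrix m n a b θ * diffProd m n θ m) =
      fun k : Fin (n - m) =>
        ((m - 1 - ν)! : ℝ) * iteratedDeriv ν (bspline θ (2 * m) (k + 1)) (θ ℓ) := by
  have hmem : ℓ ∈ Icc 1 (n + m) := mem_Icc.2 ⟨by omega, by omega⟩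
  -- Positivity is needed to read ν < μ off the truncated subtraction in `hν`.
  have hμ1 : 0 < knotMult θ (n + m) (θ ℓ) :=
    card_pos.2 ⟨ℓ, mem_filter.2 ⟨hmem, rfl⟩⟩
  have hμm := hθ.mult_le (θ ℓ)
  have hνm : ν < m := by omega
  have heq : θ ℓ = θ (ℓ + ν) :=
    (eq_add_of_lt_knotMult hθ.mono (by omega) (by omega) hfirst (by omega)).2
  have hw : ∀ k : Fin (n - m), _ := fun k =>
    exists_weights_jetDividedDiff hθ.mono hm hθ.lt_add (m + m) (k + 1) (by omega) (by omega)
  refine ⟨fun k => ?_, funext fun k => ?_⟩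
  · obtain ⟨w, hw⟩ := hw k
    exact (contDiff_bspline_two_mul hm hνm hw).contDiffAt
  obtain ⟨w, hw⟩ := hw k
  have hint := hθ.intervalIntegrable_bspline_mul_bspline hm
  calc (truncCoeffVec m n θ ℓ ν ᵥ* (gramMatrix m n a b θ * diffProd m n θ m)) k
      = ∑ i : Fin n, ∑ j : Fin n, ∫ x in a..b, truncCoeffVec m n θ ℓ ν i * diffProd m n θ m j k *
          (bspline θ m (i + 1) x * bspline θ m (j + 1) x) := by
        simp only [Matrix.vecMul, dotProduct, Matrix.mul_apply, mul_sum,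
          intervalIntegral.integral_const_mul, gramMatrix, Matrix.of_apply]
        exact sum_congr rfl fun i _ => sum_congr rfl fun j _ => by ring
    _ = ∫ x in a..b, (∑ i : Fin n, truncCoeffVec m n θ ℓ ν i * bspline θ m (i + 1) x) *
          ∑ j : Fin n, bspline θ m (j + 1) x * diffProd m n θ m j k := by
        rw [← integral_sum_sum fun i _ j _ => (hint i j).const_mul _]
        simp only [sum_mul_sum]
        congr 1 with x
        exact sum_congr rfl fun i _ => sum_congr rfl fun j _ => by ring
    _ = ∫ x in a..b, (-1) ^ m * ((m + m - 1)! / (m - 1)! : ℝ) *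
          (θ (k + 1 + (m + m)) - θ (k + 1)) *
          ∑ i ∈ Icc 1 (n + m), ∑ j ∈ range m, w i j * (((m - 1).choose j : ℝ) *
            (truncPow (m - 1 - ν) (θ ℓ - x) * truncPow (m - 1 - j) (θ i - x))) := by
        refine intervalIntegral.integral_congr_ae ?_
        filter_upwards [ae_forall_knot_ne θ (n + m)] with x hx hx'
        rw [Set.uIoc_of_le hθ.lt.le] at hx'
        rw [hθ.sum_truncCoeff_mul_bspline hm (by omega) hℓn hνm heq hx'.1 (hx ℓ hmem),
          hθ.sum_bspline_mul_diffProd hm (by omega) hw hx]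
        simp only [mul_sum]
        exact sum_congr rfl fun i _ => sum_congr rfl fun j _ => by ring
    _ = (-1) ^ m * ((m + m - 1)! / (m - 1)! : ℝ) * (θ (k + 1 + (m + m)) - θ (k + 1)) *
          ∑ i ∈ Icc 1 (n + m), ∑ j ∈ range m, w i j * (((m - 1).choose j : ℝ) *
            ∫ x in a..b, truncPow (m - 1 - ν) (θ ℓ - x) * truncPow (m - 1 - j) (θ i - x)) := by
        have hi := fun j i => intervalIntegrable_truncPow_mul_truncPow (m - 1 - ν) (m - 1 - j)
          (θ ℓ) (θ i) a b
        rw [intervalIntegral.integral_const_mul,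
          integral_sum_sum fun i _ j _ => ((hi j i).const_mul _).const_mul _]
        simp only [intervalIntegral.integral_const_mul]
    _ = ((m - 1 - ν)! : ℝ) * iteratedDeriv ν (bspline θ (2 * m) (k + 1)) (θ ℓ) := by
        rw [sum_weights_mul_integral_truncPow hθ.mono (by omega) (by omega) (by omega) hw
          (hθ.mem_Icc hm hmem).1 (hθ.mem_Icc hm hmem).2 fun i hi => (hθ.mem_Icc hm hi).1,
          iteratedDeriv_bspline_two_mul hm hνm hw,
          show m - 1 - ν + m = m + m - 1 - ν by omega]
        -- The signs come from the m difference matrices, the dropped Beta integral, and the ν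
        -- differentiations in x.
        have hsign : (-1 : ℝ) ^ m * (-1) ^ (m - 1 - ν + 1) = (-1) ^ ν := by
          rw [← pow_add, show m + (m - 1 - ν + 1) = 2 * (m - ν) + ν by omega, pow_add, pow_mul]
          simp
        rw [← hsign]
        field_simp
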